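/- Let $A$ be a unital $C^*$-algebra. A matrix $P=(P_{ij})\in M_{m,n}(A)$ with $m\le n$ is called a \emph{magic isometry} if all its entries are projections ($P_{ij}=P_{ij}^*=P_{ij}^2$), $\sum_{j=1}^{n}P_{ij}=1$ for every $i\le m$, and $P_{ij}P_{i'j}=0$ for all $j\le n$ and all $i\neq i'$. A matrix $U=(U_{ij})\in M_n(B)$ over a unital $C^*$-algebra $B$ is called a \emph{magic unitary} if all its entries are projections and $\sum_{j}U_{ij}=1=\sum_{j}U_{ji}$ for every $i\le n$. \textbf{Proposition.} Every $2\times 4$ magic isometry can be filled up to a $4\times 4$ magic unitary. That is, for every unital $C^*$-algebra $A$ and every $2\times4$ magic isometry $P=(P_{ij})\in M_{2,4}(A)$ there are a unital $C^*$-algebra $B$, a $4\times4$ magic unitary $U=(U_{ij})\in M_4(B)$, and an injective unital $*$-homomorphism $\iota\colon C^*(P_{ij})\to B$ with $\iota(P_{ij})=U_{ij}$ for all $i\in\{1,2\}$ and $j\in\{1,2,3,4\}$, where $C^*(P_{ij})\subseteq A$ denotes the $C^*$-subalgebra generated by the entries of $P$. -/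

import Mathlib

universe u

/-- An `m × n` matrix with entries in a unital C⋆-algebra is a *magic isometry* if its entries are
projections (self-adjoint idempotents), every row sums up to the unit, and distinct entries of the
same column are orthogonal. -/
structure IsMagicIsometry {A : Type u} [CStarAlgebra A] {m n : ℕ}
    (P : Matrix (Fin m) (Fin n) A) : Prop where
  isStarProjection : ∀ i j, IsStarProjection (P i j)
  row_sum : ∀ i, ∑ j, P i j = 1
  col_orthogonal : ∀ j i i', i ≠ i' → P i j * P i' j = 0

/-- An `n × n` matrix with entries in a unital C⋆-algebra is a *magic unitary* if its entries are
projections and every row and every column sums up to the unit. -/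
structure IsMagicUnitary {A : Type u} [CStarAlgebra A] {n : ℕ}
    (U : Matrix (Fin n) (Fin n) A) : Prop where
  isStarProjection : ∀ i j, IsStarProjection (U i j)
  row_sum : ∀ i, ∑ j, U i j = 1
  col_sum : ∀ j, ∑ i, U i j = 1

/-- `entryCStar P` is the (unital) C⋆-algebra `C⋆(P i j)` generated by the entries of `P` inside the
ambient C⋆-algebra: the norm closure of the star subalgebra generated by the entries. For a magic
isometry with at least one row, the unit is a sum of entries, so it makes no difference whether the
unit is adjoined. -/
def entryCStar {A : Type u} [CStarAlgebra A] {m n : ℕ} (P : Matrix (Fin m) (Fin n) A) :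
    StarSubalgebra ℂ A :=
  (StarAlgebra.adjoin ℂ {a : A | ∃ i j, P i j = a}).topologicalClosure

theorem entry_mem_entryCStar {A : Type u} [CStarAlgebra A] {m n : ℕ}
    (P : Matrix (Fin m) (Fin n) A) (i : Fin m) (j : Fin n) : P i j ∈ entryCStar P :=
  StarSubalgebra.le_topologicalClosure _
    (StarAlgebra.subset_adjoin ℂ {a : A | ∃ i j, P i j = a} ⟨i, j, rfl⟩)

/-- An `m × n` matrix `P` *can be filled up to a magic unitary* if there are a C⋆-algebra `B` and an
`n × n` magic unitary `U` over `B` such that `C⋆(P i j)` embeds into `B` (by an injective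
star homomorphism, which is then automatically isometric) with `P i j ↦ U i j` for the first `m`
rows. -/
def CanBeFilledUp {A : Type u} [CStarAlgebra A] {m n : ℕ} (hmn : m ≤ n)
    (P : Matrix (Fin m) (Fin n) A) : Prop :=
  ∃ (B : Type u) (_ : CStarAlgebra B) (U : Matrix (Fin n) (Fin n) B),
    IsMagicUnitary U ∧
      ∃ f : entryCStar P →⋆ₐ[ℂ] B, Function.Injective f ∧
        ∀ (i : Fin m) (j : Fin n),
          f ⟨P i j, entry_mem_entryCStar P i j⟩ = U (Fin.castLE hmn i) j

/-! Write $p_j,p'_j$ for the two rows and $q_j=p_j+p'_j$. A third row amounts to projections $r_j\le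
1-q_j$ with $\sum_j r_j=1$; the fourth row is then $1-q_j-r_j$, whose sum is $4-2-1=1$. The squares
$x_{jk}=(q_j+q_k-1)^2$, $j\ne k$, are central in $C^*(P_{ij})$ (`commute_sq_entry`). For a
fixed-point-free involution τ of the columns, $x=x_{j\tau(j)}$ does not depend on $j$, and
$c_j=(1-q_j)p_{\tau(j)}(1-q_j)$ satisfies $c_j^2=(1-x)c_j$ (`compression_mul_self`) and $\sum_j
c_j=1-x$ (`sum_compression`). Hence $r_j=(1-x)^{-1}c_j$ works wherever $1-x$ is invertible. Since
$x_{01}+x_{02}+x_{03}=1$ with all terms positive, $1-x_{01}$ and $1-x_{02}$ never vanish together.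
Filling separately over two ideals, where one or the other is invertible, and taking the product
gives an injective map. -/

open scoped MultiplierAlgebra

/-! ### Localization at a central element via multipliers of an ideal. -/

section FixedIdeal

variable {C : Type u} [CStarAlgebra C]

/-- The closed ideal of all elements on which a central self-adjoint element `w` acts as the
identity. -/
def fixedIdeal (w : C) (hw : IsSelfAdjoint w) (hc : ∀ a, Commute w a) :
    NonUnitalStarSubalgebra ℂ C where
  carrier := {b | w * b = b}
  add_mem' {a b} ha hb := by
    simp only [Set.mem_ofPred_eq] at *
    rw [mul_add, ha, hb]
  zero_mem' := mul_zero w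
  mul_mem' {a b} ha _ := by
    simp only [Set.mem_ofPred_eq] at *
    rw [← mul_assoc, ha]
  smul_mem' c a ha := by
    simp only [Set.mem_ofPred_eq] at *
    rw [mul_smul_comm, ha]
  star_mem' {a} ha := by
    simp only [Set.mem_ofPred_eq] at *
    rw [(hc _).eq]
    nth_rewrite 1 [← hw.star_eq]
    rw [← star_mul, ha]

variable (w : C) (hw : IsSelfAdjoint w) (hc : ∀ a, Commute w a)

theorem mem_fixedIdeal {b : C} : b ∈ fixedIdeal w hw hc ↔ w * b = b := Iff.rfl

instance isClosed_fixedIdeal : IsClosed (fixedIdeal w hw hc : Set C) :=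
  isClosed_eq (continuous_const.mul continuous_id) continuous_id

theorem mul_mem_fixedIdeal_left (a : C) {b : C} (hb : b ∈ fixedIdeal w hw hc) :
    a * b ∈ fixedIdeal w hw hc := by
  rw [mem_fixedIdeal] at *
  rw [← mul_assoc, (hc a).eq, mul_assoc, hb]

theorem mul_mem_fixedIdeal_right (a : C) {b : C} (hb : b ∈ fixedIdeal w hw hc) :
    b * a ∈ fixedIdeal w hw hc := by
  rw [mem_fixedIdeal] at *
  rw [← mul_assoc, hb]

/-- Left multiplication by an element of the algebra on `fixedIdeal`. -/
noncomputable def fixedIdealMulLeft (a : C) : fixedIdeal w hw hc →L[ℂ] fixedIdeal w hw hc :=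
  LinearMap.mkContinuous
    { toFun := fun b => ⟨a * b, mul_mem_fixedIdeal_left w hw hc a b.2⟩
      map_add' := fun b c => Subtype.ext (mul_add a b c)
      map_smul' := fun r b => Subtype.ext (mul_smul_comm r a (b : C)) }
    ‖a‖ (fun b => norm_mul_le a (b : C))

/-- Right multiplication by an element of the algebra on `fixedIdeal`. -/
noncomputable def fixedIdealMulRight (a : C) : fixedIdeal w hw hc →L[ℂ] fixedIdeal w hw hc :=
  LinearMap.mkContinuous
    { toFun := fun b => ⟨b * a, mul_mem_fixedIdeal_right w hw hc a b.2⟩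
      map_add' := fun b c => Subtype.ext (add_mul (b : C) c a)
      map_smul' := fun r b => Subtype.ext (smul_mul_assoc r (b : C) a) }
    ‖a‖ (fun b => (norm_mul_le (b : C) a).trans_eq (mul_comm _ _))

@[simp] theorem coe_fixedIdealMulLeft (a : C) (b : fixedIdeal w hw hc) :
    (fixedIdealMulLeft w hw hc a b : C) = a * b := rfl

@[simp] theorem coe_fixedIdealMulRight (a : C) (b : fixedIdeal w hw hc) :
    (fixedIdealMulRight w hw hc a b : C) = b * a := rfl

/-- The action of a unital C⋆-algebra by multipliers of `fixedIdeal`. -/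
noncomputable def toMultiplier : C →⋆ₐ[ℂ] 𝓜(ℂ, fixedIdeal w hw hc) where
  toFun a := ⟨(fixedIdealMulLeft w hw hc a, fixedIdealMulRight w hw hc a),
    fun x y => Subtype.ext (mul_assoc (x : C) a y)⟩
  map_one' := by
    refine DoubleCentralizer.ext _ _ _ _ (Prod.ext ?_ ?_) <;> ext b <;> simp
  map_mul' a a' := by
    refine DoubleCentralizer.ext _ _ _ _ (Prod.ext ?_ ?_) <;> ext b <;> simp [mul_assoc]
  map_zero' := by
    refine DoubleCentralizer.ext _ _ _ _ (Prod.ext ?_ ?_) <;> ext b <;> simp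
  map_add' a a' := by
    refine DoubleCentralizer.ext _ _ _ _ (Prod.ext ?_ ?_) <;> ext b <;> simp [mul_add, add_mul]
  commutes' r := by
    refine DoubleCentralizer.ext _ _ _ _ (Prod.ext ?_ ?_) <;> ext b <;>
      simp [Algebra.algebraMap_eq_smul_one]
  map_star' a := by
    refine DoubleCentralizer.ext _ _ _ _ (Prod.ext ?_ ?_) <;> ext b <;> simp

theorem mul_eq_zero_of_toMultiplier_eq_zero {a b : C} (ha : toMultiplier w hw hc a = 0)
    (hb : w * b = b) : a * b = 0 := by
  have h := congrArg (fun m : 𝓜(ℂ, fixedIdeal w hw hc) => (m.fst ⟨b, hb⟩ : C)) ha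
  simpa [toMultiplier] using h

/-- Taking `w = h * (1 - x)`, the image of `h` becomes a genuine inverse of the image of `1 - x`. -/
theorem toMultiplier_self : toMultiplier w hw hc w = 1 := by
  refine DoubleCentralizer.ext _ _ _ _ (Prod.ext ?_ ?_) <;> ext b
  · exact (mem_fixedIdeal w hw hc).mp b.2
  · exact (hc b).eq.symm.trans ((mem_fixedIdeal w hw hc).mp b.2)

end FixedIdeal

/-! ### Relations between column sums and compressed entries. -/

section Filling

/-- For projections `p ⟂ q` and `p' ⟂ q'` with `p ⟂ p'` and `q ⟂ q'`, compressing by `p` the square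
of `p + q + p' + q' - 1` gives `p * q' * p`. -/
theorem mul_sq_eq_mul_mul {R : Type*} [Ring R] {p q p' q' : R} (hp : p * p = p)
    (hq' : q' * q' = q') (hpq : p * q = 0) (hpp' : p * p' = 0) (hqq' : q' * q = 0)
    (hqp' : q' * p' = 0) : p * (p + q + (p' + q') - 1) ^ 2 = p * q' * p := by
  have h1 : p * (p + q + (p' + q') - 1) = p * q' := by
    simp only [mul_add, mul_sub, hp, hpq, hpp', mul_one]
    abel
  have h2 : q' * (p + q + (p' + q') - 1) = q' * p := by
    simp only [mul_add, mul_sub, hq', hqq', hqp', mul_one]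
    abel
  rw [sq, ← mul_assoc, h1, mul_assoc, h2, mul_assoc]

theorem sq_mul_eq_mul_mul {R : Type*} [Ring R] {p q p' q' : R} (hp : p * p = p)
    (hq' : q' * q' = q') (hpq : q * p = 0) (hpp' : p' * p = 0) (hqq' : q * q' = 0)
    (hqp' : p' * q' = 0) : (p + q + (p' + q') - 1) ^ 2 * p = p * q' * p := by
  have h1 : (p + q + (p' + q') - 1) * p = q' * p := by
    simp only [add_mul, sub_mul, hp, hpq, hpp', one_mul]
    abel
  have h2 : (p + q + (p' + q') - 1) * q' = p * q' := by
    simp only [add_mul, sub_mul, hq', hqq', hqp', one_mul]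
    abel
  rw [sq, mul_assoc, h1, ← mul_assoc, h2]

variable {C : Type u} [CStarAlgebra C]

/-- Projections in a C⋆-algebra whose sum is the unit are pairwise orthogonal. -/
theorem IsMagicIsometry.row_orthogonal {m n : ℕ} {P : Matrix (Fin m) (Fin n) C}
    (hP : IsMagicIsometry P) (i : Fin m) {j k : Fin n} (hjk : j ≠ k) : P i j * P i k = 0 := by
  let _ := CStarAlgebra.spectralOrder C
  have _ := CStarAlgebra.spectralOrderedRing C
  -- The complement of one projection is the sum of the others, all positive, so it dominates each
  -- of them.
  have hle : P i j ≤ 1 - P i k := by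
    rw [← hP.row_sum i, ← Finset.sum_erase_eq_sub (Finset.mem_univ k)]
    exact Finset.single_le_sum (f := P i) (fun l _ => (hP.isStarProjection i l).nonneg)
      (Finset.mem_erase.mpr ⟨hjk, Finset.mem_univ j⟩)
  have h := ((hP.isStarProjection i j).le_iff_mul_eq_left
    (hP.isStarProjection i k).one_sub).mp hle
  rwa [mul_sub, mul_one, sub_eq_self] at h

/-- The column sum of a two-row matrix. -/
abbrev colSum {n : ℕ} (P : Matrix (Fin 2) (Fin n) C) (j : Fin n) : C := P 0 j + P 1 j

/-- Multiplying the square by an entry from either side gives the same product `p * q' * p`. -/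
theorem IsMagicIsometry.commute_sq {n : ℕ} {P : Matrix (Fin 2) (Fin n) C}
    (hP : IsMagicIsometry P) {j k : Fin n} (hjk : j ≠ k) (i : Fin 2) :
    Commute ((colSum P j + colSum P k - 1) ^ 2) (P i j) := by
  have idem := fun i j => (hP.isStarProjection i j).isIdempotentElem.eq
  have col := hP.col_orthogonal
  have row := fun i => hP.row_orthogonal i hjk
  have row' := fun i => hP.row_orthogonal i hjk.symm
  fin_cases i
  · exact (sq_mul_eq_mul_mul (idem _ _) (idem _ _) (col _ _ _ (by decide)) (row' 0) (row 1)
      (col _ _ _ (by decide))).trans (mul_sq_eq_mul_mul (idem _ _) (idem _ _)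
      (col _ _ _ (by decide)) (row 0) (row' 1) (col _ _ _ (by decide))).symm
  · have e : colSum P j + colSum P k - 1 = P 1 j + P 0 j + (P 1 k + P 0 k) - 1 := by
      simp only [colSum]; abel
    rw [e]
    exact (sq_mul_eq_mul_mul (idem _ _) (idem _ _) (col _ _ _ (by decide)) (row' 1) (row 0)
      (col _ _ _ (by decide))).trans (mul_sq_eq_mul_mul (idem _ _) (idem _ _)
      (col _ _ _ (by decide)) (row 1) (row' 0) (col _ _ _ (by decide))).symm

/-- The compression of the first-row entry `P 0 k` to the complement of the `j`-th column sum. -/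
abbrev compression {n : ℕ} (P : Matrix (Fin 2) (Fin n) C) (j k : Fin n) : C :=
  (1 - colSum P j) * P 0 k * (1 - colSum P j)

theorem IsMagicIsometry.isStarProjection_colSum {n : ℕ} {P : Matrix (Fin 2) (Fin n) C}
    (hP : IsMagicIsometry P) (j : Fin n) : IsStarProjection (colSum P j) :=
  (hP.isStarProjection 0 j).add (hP.isStarProjection 1 j) (hP.col_orthogonal j 0 1 (by decide))

theorem IsMagicIsometry.compression_eq {n : ℕ} {P : Matrix (Fin 2) (Fin n) C}
    (hP : IsMagicIsometry P) {j k : Fin n} (hjk : j ≠ k) :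
    compression P j k = P 0 k - (P 1 j * P 0 k + P 0 k * P 1 j) +
      (colSum P j + colSum P k - 1) ^ 2 * P 1 j := by
  have idem := fun i j => (hP.isStarProjection i j).isIdempotentElem.eq
  have col := hP.col_orthogonal
  have e : colSum P j + colSum P k - 1 = P 1 j + P 0 j + (P 1 k + P 0 k) - 1 := by
    simp only [colSum]; abel
  rw [e, sq_mul_eq_mul_mul (idem _ _) (idem _ _) (col _ _ _ (by decide))
    (hP.row_orthogonal 1 hjk.symm) (hP.row_orthogonal 0 hjk) (col _ _ _ (by decide))]
  have h1 : (1 - colSum P j) * P 0 k = P 0 k - P 1 j * P 0 k := by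
    simp only [colSum, sub_mul, add_mul, hP.row_orthogonal 0 hjk, one_mul, zero_add]
  have h2 : P 0 k * (1 - colSum P j) = P 0 k - P 0 k * P 1 j := by
    simp only [colSum, mul_sub, mul_add, hP.row_orthogonal 0 hjk.symm, mul_one, zero_add]
  rw [compression, h1, sub_mul, mul_assoc (P 1 j), h2, mul_sub, ← mul_assoc]
  abel

/-- Squaring produces the inner factor `P 0 k * (1 - colSum P j) * P 0 k`. Row orthogonality leaves
only the `P 1 j` term of the column sum, so this factor is `(1 - x) * P 0 k`. -/
theorem IsMagicIsometry.compression_mul_self {n : ℕ} {P : Matrix (Fin 2) (Fin n) C}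
    (hP : IsMagicIsometry P) {j k : Fin n} (hjk : j ≠ k)
    (hx : Commute ((colSum P j + colSum P k - 1) ^ 2) (colSum P j)) :
    compression P j k * compression P j k =
      (1 - (colSum P j + colSum P k - 1) ^ 2) * compression P j k := by
  have idem := fun i j => (hP.isStarProjection i j).isIdempotentElem.eq
  have col := hP.col_orthogonal
  have he : (1 - colSum P j) * (1 - colSum P j) = 1 - colSum P j :=
    (hP.isStarProjection_colSum j).one_sub.isIdempotentElem.eq
  set x := (colSum P j + colSum P k - 1) ^ 2 with hxdef
  have e : x = (P 0 k + P 1 k + (P 0 j + P 1 j) - 1) ^ 2 := by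
    rw [hxdef]; simp only [colSum]; congr 1; abel
  have hxp : x * P 0 k = P 0 k * P 1 j * P 0 k := by
    rw [e]
    exact sq_mul_eq_mul_mul (idem _ _) (idem _ _) (col _ _ _ (by decide))
      (hP.row_orthogonal 0 hjk) (hP.row_orthogonal 1 hjk.symm) (col _ _ _ (by decide))
  have key : P 0 k * (1 - colSum P j) * P 0 k = (1 - x) * P 0 k := by
    rw [sub_mul, hxp, one_mul]
    simp only [colSum, mul_sub, mul_add, hP.row_orthogonal 0 hjk.symm, mul_one, zero_add, sub_mul,
      idem]
  have hc : Commute (1 - x) (1 - colSum P j) :=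
    (((Commute.one_left _).sub_left ((Commute.one_right _).sub_right hx)))
  calc compression P j k * compression P j k
      = (1 - colSum P j) * (P 0 k * ((1 - colSum P j) * (1 - colSum P j)) * P 0 k) *
          (1 - colSum P j) := by simp only [compression, mul_assoc]
    _ = (1 - x) * compression P j k := by
      rw [he, key, ← mul_assoc, ← hc.eq]
      simp only [compression, mul_assoc]

theorem IsMagicIsometry.sum_colSum {n : ℕ} {P : Matrix (Fin 2) (Fin n) C}
    (hP : IsMagicIsometry P) : ∑ j, colSum P j = 2 := by
  rw [Finset.sum_add_distrib, hP.row_sum, hP.row_sum, one_add_one_eq_two]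

theorem IsMagicIsometry.sq_eq {n : ℕ} {P : Matrix (Fin 2) (Fin n) C}
    (hP : IsMagicIsometry P) (j k : Fin n) :
    (colSum P j + colSum P k - 1) ^ 2 =
      1 - colSum P j - colSum P k + (colSum P j * colSum P k + colSum P k * colSum P j) := by
  have h := fun j => (hP.isStarProjection_colSum j).isIdempotentElem.eq
  simp only [sq, sub_mul, add_mul, mul_sub, mul_add _ (colSum P j), h, mul_one, one_mul]
  abel

/-- By `compression_eq` the sum is `1 - S + x`, with `S` the sum of the cross terms. Summing `sq_eq`
over the four columns gives `4x = 2S`, because the linear terms cancel (`4 - 2 - 2 = 0`) and τ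
exchanges the two kinds of cross terms. -/
theorem IsMagicIsometry.sum_compression {P : Matrix (Fin 2) (Fin 4) C}
    (hP : IsMagicIsometry P) {τ : Fin 4 → Fin 4} (hτ : Function.Involutive τ)
    (hne : ∀ j, j ≠ τ j) {x : C} (hx : ∀ j, (colSum P j + colSum P (τ j) - 1) ^ 2 = x) :
    ∑ j, compression P j (τ j) = 1 - x := by
  have reindex : ∀ g : Fin 4 → C, ∑ j, g (τ j) = ∑ j, g j := Equiv.sum_comp hτ.toPerm
  set S := ∑ j, (P 1 j * P 0 (τ j) + P 0 (τ j) * P 1 j) with hS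
  have hS' : ∑ j, (P 0 j * P 1 (τ j) + P 1 (τ j) * P 0 j) = S := by
    rw [hS, ← reindex]
    refine Finset.sum_congr rfl fun j _ => ?_
    rw [hτ j]
    abel
  have h4 : ∑ _j : Fin 4, x = S + S := by
    calc ∑ _j : Fin 4, x
        = ∑ j, (1 - colSum P j - colSum P (τ j) +
            ((P 1 j * P 0 (τ j) + P 0 (τ j) * P 1 j) +
              (P 0 j * P 1 (τ j) + P 1 (τ j) * P 0 j))) := by
          refine Finset.sum_congr rfl fun j _ => ?_
          rw [← hx j, hP.sq_eq]
          simp only [colSum, add_mul, mul_add, hP.row_orthogonal _ (hne j),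
            hP.row_orthogonal _ (hne j).symm]
          abel
      _ = S + S := by
          rw [Finset.sum_add_distrib, Finset.sum_add_distrib, hS', Finset.sum_sub_distrib,
            Finset.sum_sub_distrib, reindex (fun j => colSum P j), hP.sum_colSum]
          rw [← hS, Finset.sum_const, Finset.card_univ, Fintype.card_fin]
          norm_num
  have hS2 : S = 2 * x := by
    have h : (2 : ℂ) • S = (2 : ℂ) • (2 * x) := by
      rw [two_smul, ← h4, two_smul, Finset.sum_const, Finset.card_univ, Fintype.card_fin]
      noncomm_ring
    exact smul_right_injective C two_ne_zero h
  calc ∑ j, compression P j (τ j)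
      = ∑ j, (P 0 (τ j) - (P 1 j * P 0 (τ j) + P 0 (τ j) * P 1 j) + x * P 1 j) :=
        Finset.sum_congr rfl fun j _ => by rw [hP.compression_eq (hne j), hx j]
    _ = 1 - x := by
      rw [Finset.sum_add_distrib, Finset.sum_sub_distrib, reindex (fun j => P 0 j), hP.row_sum,
        ← Finset.mul_sum, hP.row_sum, ← hS, hS2]
      noncomm_ring

theorem IsMagicIsometry.isSelfAdjoint_sq {n : ℕ} {P : Matrix (Fin 2) (Fin n) C}
    (hP : IsMagicIsometry P) (j k : Fin n) : IsSelfAdjoint ((colSum P j + colSum P k - 1) ^ 2) :=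
  (((hP.isStarProjection_colSum j).isSelfAdjoint.add
    (hP.isStarProjection_colSum k).isSelfAdjoint).sub (.one C)).pow 2

/-! ### Filling over one localization, and gluing two of them. -/

/-- Given a quasi-inverse `h` of `1 - x`, a `2 × 4` magic isometry can be filled up after passing to
the multipliers of the ideal on which `h * (1 - x)` acts as the identity. -/
theorem IsMagicIsometry.exists_filling_of_quasiInverse {P : Matrix (Fin 2) (Fin 4) C}
    (hP : IsMagicIsometry P) {τ : Fin 4 → Fin 4} (hτ : Function.Involutive τ)
    (hne : ∀ j, j ≠ τ j) {x : C} (hx : ∀ j, (colSum P j + colSum P (τ j) - 1) ^ 2 = x)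
    (hxc : ∀ a, Commute x a) {h : C} (hh : IsSelfAdjoint h) (hhc : ∀ a, Commute h a) :
    ∃ (B : Type u) (_ : CStarAlgebra B) (U : Matrix (Fin 4) (Fin 4) B) (f : C →⋆ₐ[ℂ] B),
      IsMagicUnitary U ∧ (∀ i j, f (P i j) = U (Fin.castLE (by norm_num : 2 ≤ 4) i) j) ∧
        ∀ a b, f a = 0 → h * (1 - x) * b = b → a * b = 0 := by
  have hxs : IsSelfAdjoint x := hx 0 ▸ hP.isSelfAdjoint_sq _ _
  have hw : IsSelfAdjoint (h * (1 - x)) :=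
    (IsSelfAdjoint.commute_iff hh ((IsSelfAdjoint.one C).sub hxs)).mp (hhc _)
  have hwc : ∀ a, Commute (h * (1 - x)) a := fun a =>
    (hhc a).mul_left ((Commute.one_left a).sub_left (hxc a))
  let f := toMultiplier (h * (1 - x)) hw hwc
  have hf : f (h * (1 - x)) = 1 := toMultiplier_self _ hw hwc
  let r : Fin 4 → C := fun j => h * compression P j (τ j)
  have hr_sq : ∀ j, r j * r j = h * (1 - x) * r j := by
    intro j
    calc r j * r j = h * (h * (compression P j (τ j) * compression P j (τ j))) := by
          simp only [r]
          rw [mul_assoc, ← mul_assoc (compression P j (τ j)), ← (hhc (compression P j (τ j))).eq,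
            mul_assoc h (compression P j (τ j))]
      _ = h * (1 - x) * r j := by
          rw [hP.compression_mul_self (hne j) (by rw [hx j]; exact hxc _), hx j,
            ← mul_assoc h (1 - x), ← mul_assoc h, ← (hwc h).eq, mul_assoc]
  have hcs : ∀ j, IsSelfAdjoint (1 - colSum P j) := fun j =>
    (hP.isStarProjection_colSum j).one_sub.isSelfAdjoint
  have hr_sa : ∀ j, IsSelfAdjoint (r j) := by
    intro j
    refine (IsSelfAdjoint.commute_iff hh ?_).mp (hhc _)
    simp only [IsSelfAdjoint, compression, star_mul, (hcs j).star_eq,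
      (hP.isStarProjection 0 (τ j)).isSelfAdjoint.star_eq, mul_assoc]
  have hr_mul : ∀ j, r j * (1 - colSum P j) = r j := by
    intro j
    simp only [r, compression, mul_assoc,
      (hP.isStarProjection_colSum j).one_sub.isIdempotentElem.eq]
  have hr_sum : ∑ j, r j = h * (1 - x) := by
    rw [← Finset.mul_sum, hP.sum_compression hτ hne hx]
  have hr : ∀ j, IsStarProjection (f (r j)) := fun j =>
    ⟨by rw [IsIdempotentElem, ← map_mul, hr_sq, map_mul, hf, one_mul], (hr_sa j).map f⟩
  have hfr : ∑ j, f (r j) = 1 := by rw [← map_sum, hr_sum, hf]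
  let U : Matrix (Fin 4) (Fin 4) 𝓜(ℂ, fixedIdeal (h * (1 - x)) hw hwc) := fun i j =>
    ![f (P 0 j), f (P 1 j), f (r j), f (1 - colSum P j) - f (r j)] i
  refine ⟨_, inferInstance, U, f, ⟨?_, ?_, ?_⟩, ?_, ?_⟩
  · intro i j
    fin_cases i
    · exact (hP.isStarProjection 0 j).map f
    · exact (hP.isStarProjection 1 j).map f
    · exact hr j
    · exact (hr j).sub_of_mul_eq_left ((hP.isStarProjection_colSum j).one_sub.map f)
        (by rw [← map_mul, hr_mul])
  · intro i
    fin_cases i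
    · exact (map_sum f _ _).symm.trans (by rw [hP.row_sum, map_one])
    · exact (map_sum f _ _).symm.trans (by rw [hP.row_sum, map_one])
    · exact hfr
    · change ∑ j, (f (1 - colSum P j) - f (r j)) = 1
      rw [Finset.sum_sub_distrib, hfr, ← map_sum, Finset.sum_sub_distrib, hP.sum_colSum]
      rw [Finset.sum_const, Finset.card_univ, Fintype.card_fin, nsmul_one, map_sub, map_natCast,
        map_ofNat]
      norm_num
  · intro j
    simp [U, Fin.sum_univ_four]
  · intro i j
    fin_cases i <;> rfl
  · intro a b ha hb
    exact mul_eq_zero_of_toMultiplier_eq_zero _ hw hwc ha hb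

/-- For a central self-adjoint `x` there are a central self-adjoint `h` and an `l ≥ 2 / 3 - x` such
that `h` inverts `1 - x` on `l`. -/
theorem exists_quasiInverse_one_sub [PartialOrder C] [StarOrderedRing C] {x : C}
    (hxs : IsSelfAdjoint x) (hxc : ∀ a, Commute x a) :
    ∃ h l : C, IsSelfAdjoint h ∧ (∀ a, Commute h a) ∧ h * (1 - x) * l = l ∧
      algebraMap ℝ C (2 / 3) - x ≤ l := by
  -- The cutoff 2/3 lies strictly between 1/2 and 1: below 1 keeps `1 - t ≥ 1/3` on the support of
  -- `l`, and above 1/2 makes two such `l` add up to an invertible element.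
  have hpos : ∀ t : ℝ, max (1 / 3) (1 - t) ≠ 0 := fun t =>
    (lt_max_of_lt_left (by norm_num)).ne'
  have hcont : Continuous fun t : ℝ => (max (1 / 3) (1 - t))⁻¹ :=
    (by fun_prop : Continuous fun t : ℝ => max (1 / 3) (1 - t)).inv₀ hpos
  have hsub : ∀ r : ℝ, cfc (fun t : ℝ => r - t) x = algebraMap ℝ C r - x := fun r => by
    rw [cfc_sub (fun _ : ℝ => r) (fun t : ℝ => t) x, cfc_const r x, cfc_id' ℝ x]
  refine ⟨cfc (fun t : ℝ => (max (1 / 3) (1 - t))⁻¹) x, cfc (fun t : ℝ => max 0 (2 / 3 - t)) x,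
    cfc_predicate _ x, fun a => hxs.commute_cfc (hxc a) _, ?_, ?_⟩
  · have h1 : (1 : C) - x = cfc (fun t : ℝ => 1 - t) x := by rw [hsub, map_one]
    rw [h1, ← cfc_mul _ _ x hcont.continuousOn (by fun_prop),
      ← cfc_mul (fun t : ℝ => (max (1 / 3) (1 - t))⁻¹ * (1 - t)) _ x
        (hcont.mul (by fun_prop)).continuousOn (by fun_prop)]
    refine cfc_congr fun t _ => ?_
    change (max (1 / 3) (1 - t))⁻¹ * (1 - t) * max 0 (2 / 3 - t) = max 0 (2 / 3 - t)
    rcases le_total t (2 / 3) with ht | ht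
    · rw [max_eq_right (by linarith : 1 / 3 ≤ 1 - t), inv_mul_cancel₀ (by linarith), one_mul]
    · rw [max_eq_left (by linarith : 2 / 3 - t ≤ 0), mul_zero]
  · rw [← hsub]
    exact cfc_mono fun t _ => le_max_right _ _

/-- The four column sums add up to 2, so complementary pairs give opposite values before squaring.
-/
theorem IsMagicIsometry.sq_eq_sq_of_nodup {P : Matrix (Fin 2) (Fin 4) C}
    (hP : IsMagicIsometry P) {j k l m : Fin 4} (h : [j, k, l, m].Nodup) :
    (colSum P l + colSum P m - 1) ^ 2 = (colSum P j + colSum P k - 1) ^ 2 := by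
  have huniv : Finset.univ = [j, k, l, m].toFinset := by
    revert j k l m; decide
  have hsum := hP.sum_colSum
  rw [huniv, List.sum_toFinset _ h] at hsum
  have hneg : colSum P l + colSum P m - 1 = -(colSum P j + colSum P k - 1) := by
    rw [eq_neg_iff_add_eq_zero, ← sub_eq_zero.mpr hsum, ← one_add_one_eq_two]
    simp only [List.map_cons, List.map_nil, List.sum_cons, List.sum_nil]
    abel
  rw [hneg, neg_sq]

theorem IsMagicIsometry.sq_add_sq_add_sq {P : Matrix (Fin 2) (Fin 4) C} (hP : IsMagicIsometry P) :
    (colSum P 0 + colSum P 1 - 1) ^ 2 + (colSum P 0 + colSum P 2 - 1) ^ 2 +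
      (colSum P 0 + colSum P 3 - 1) ^ 2 = 1 := by
  have h3 : colSum P 3 = 2 - colSum P 0 - colSum P 1 - colSum P 2 := by
    rw [← hP.sum_colSum, Fin.sum_univ_four]; abel
  have h0 := (hP.isStarProjection_colSum 0).isIdempotentElem.eq
  rw [hP.sq_eq, hP.sq_eq, hP.sq_eq, h3]
  simp only [mul_sub, sub_mul, h0]
  noncomm_ring
  norm_num

/-- If the squares `(colSum P 0 + colSum P j - 1) ^ 2` are central, a `2 × 4` magic isometry can be
filled up. -/
theorem IsMagicIsometry.exists_filling_of_central {P : Matrix (Fin 2) (Fin 4) C}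
    (hP : IsMagicIsometry P)
    (hc : ∀ j k : Fin 4, j ≠ k → ∀ a, Commute ((colSum P j + colSum P k - 1) ^ 2) a) :
    ∃ (B : Type u) (_ : CStarAlgebra B) (U : Matrix (Fin 4) (Fin 4) B) (f : C →⋆ₐ[ℂ] B),
      IsMagicUnitary U ∧ Function.Injective f ∧
        ∀ i j, f (P i j) = U (Fin.castLE (by norm_num : 2 ≤ 4) i) j := by
  let _ := CStarAlgebra.spectralOrder C
  have _ := CStarAlgebra.spectralOrderedRing C
  obtain ⟨h₁, l₁, hs₁, hc₁, hl₁, hle₁⟩ :=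
    exists_quasiInverse_one_sub (hP.isSelfAdjoint_sq 0 1) (hc 0 1 (by decide))
  obtain ⟨h₂, l₂, hs₂, hc₂, hl₂, hle₂⟩ :=
    exists_quasiInverse_one_sub (hP.isSelfAdjoint_sq 0 2) (hc 0 2 (by decide))
  obtain ⟨B₁, _, U₁, f₁, hU₁, hf₁, hk₁⟩ := hP.exists_filling_of_quasiInverse
    (τ := ![1, 0, 3, 2]) (by unfold Function.Involutive; decide) (by decide) (x := (colSum P 0 + colSum P 1 - 1) ^ 2)
    (by
      intro j
      fin_cases j
      · rfl
      · exact congrArg (fun y => (y - 1) ^ 2) (add_comm _ _)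
      · exact hP.sq_eq_sq_of_nodup (by decide)
      · exact hP.sq_eq_sq_of_nodup (by decide))
    (hc 0 1 (by decide)) hs₁ hc₁
  obtain ⟨B₂, _, U₂, f₂, hU₂, hf₂, hk₂⟩ := hP.exists_filling_of_quasiInverse
    (τ := ![2, 3, 0, 1]) (by unfold Function.Involutive; decide) (by decide) (x := (colSum P 0 + colSum P 2 - 1) ^ 2)
    (by
      intro j
      fin_cases j
      · rfl
      · exact hP.sq_eq_sq_of_nodup (by decide)
      · exact congrArg (fun y => (y - 1) ^ 2) (add_comm _ _)
      · exact hP.sq_eq_sq_of_nodup (by decide))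
    (hc 0 2 (by decide)) hs₂ hc₂
  -- The lower bound is `4/3 - x₀₁ - x₀₂ = 1/3 + x₀₃ ≥ 1/3`. An element killed by both maps
  -- annihilates `l₁ + l₂`, hence is zero.
  have hunit : IsUnit (l₁ + l₂) := by
    have hZ : 0 ≤ (colSum P 0 + colSum P 3 - 1) ^ 2 :=
      (((hP.isStarProjection_colSum 0).isSelfAdjoint.add
        (hP.isStarProjection_colSum 3).isSelfAdjoint).sub (.one C)).sq_nonneg
    refine CStarAlgebra.isUnit_of_le (algebraMap ℝ C (1 / 3)) ?_
      (isStrictlyPositive_algebraMap (by norm_num))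
    refine le_trans ?_ (add_le_add hle₁ hle₂)
    have e : algebraMap ℝ C (2 / 3) - (colSum P 0 + colSum P 1 - 1) ^ 2 +
        (algebraMap ℝ C (2 / 3) - (colSum P 0 + colSum P 2 - 1) ^ 2) =
        algebraMap ℝ C (1 / 3) + (colSum P 0 + colSum P 3 - 1) ^ 2 := by
      have h43 : algebraMap ℝ C (2 / 3) + algebraMap ℝ C (2 / 3) = algebraMap ℝ C (1 / 3) + 1 := by
        rw [← map_add, ← map_one (algebraMap ℝ C), ← map_add]; norm_num
      rw [sub_add_sub_comm, h43, add_sub_assoc, ← eq_sub_of_add_eq' hP.sq_add_sq_add_sq]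
    rw [e]
    exact le_add_of_nonneg_right hZ
  refine ⟨B₁ × B₂, inferInstance, fun i j => (U₁ i j, U₂ i j), f₁.prod f₂, ⟨?_, ?_, ?_⟩, ?_, ?_⟩
  · intro i j
    exact ⟨Prod.ext (hU₁.isStarProjection i j).isIdempotentElem.eq
      (hU₂.isStarProjection i j).isIdempotentElem.eq,
      Prod.ext (hU₁.isStarProjection i j).isSelfAdjoint.star_eq
      (hU₂.isStarProjection i j).isSelfAdjoint.star_eq⟩
  · intro i
    exact Prod.ext (by simp [Prod.fst_sum, hU₁.row_sum]) (by simp [Prod.snd_sum, hU₂.row_sum])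
  · intro j
    exact Prod.ext (by simp [Prod.fst_sum, hU₁.col_sum]) (by simp [Prod.snd_sum, hU₂.col_sum])
  · rw [injective_iff_map_eq_zero]
    intro a ha
    have h : a * (l₁ + l₂) = 0 := by
      rw [mul_add, hk₁ a l₁ (congrArg Prod.fst ha) hl₁, hk₂ a l₂ (congrArg Prod.snd ha) hl₂,
        add_zero]
    exact hunit.mul_left_eq_zero.mp h
  · intro i j
    exact Prod.ext (hf₁ i j) (hf₂ i j)

end Filling

/-! ### Centrality in the generated algebra, and the conclusion. -/

/-- The entries of a matrix, as elements of the C⋆-algebra they generate. -/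
def entryMatrix {A : Type u} [CStarAlgebra A] {m n : ℕ} (P : Matrix (Fin m) (Fin n) A) :
    Matrix (Fin m) (Fin n) (entryCStar P) :=
  fun i j => ⟨P i j, entry_mem_entryCStar P i j⟩

instance isClosed_entryCStar {A : Type u} [CStarAlgebra A] {m n : ℕ}
    (P : Matrix (Fin m) (Fin n) A) : IsClosed (entryCStar P : Set A) :=
  StarSubalgebra.isClosed_topologicalClosure _

theorem IsMagicIsometry.entryMatrix {A : Type u} [CStarAlgebra A] {m n : ℕ}
    {P : Matrix (Fin m) (Fin n) A} (hP : IsMagicIsometry P) :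
    IsMagicIsometry (entryMatrix P) where
  isStarProjection i j := ⟨Subtype.ext (hP.isStarProjection i j).isIdempotentElem.eq,
    Subtype.ext (hP.isStarProjection i j).isSelfAdjoint.star_eq⟩
  row_sum i := Subtype.ext (by
    rw [AddSubmonoidClass.coe_finsetSum]
    exact hP.row_sum i)
  col_orthogonal j i i' h := Subtype.ext (hP.col_orthogonal j i i' h)

/-- A self-adjoint element commuting with the entries of `P` commutes with `C⋆(P i j)`. -/
theorem commute_of_commute_entries {A : Type u} [CStarAlgebra A] {m n : ℕ}
    {P : Matrix (Fin m) (Fin n) A} {x : A} (hx : IsSelfAdjoint x) (h : ∀ i j, Commute x (P i j))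
    {a : A} (ha : a ∈ entryCStar P) : Commute x a := by
  have hle : entryCStar P ≤ StarSubalgebra.centralizer ℂ {x} := by
    refine StarSubalgebra.topologicalClosure_minimal (StarAlgebra.adjoin_le ?_)
      (Set.isClosed_centralizer _)
    rintro _ ⟨i, j, rfl⟩
    rw [SetLike.mem_coe, StarSubalgebra.mem_centralizer_iff]
    rintro _ rfl
    rw [hx.star_eq]
    exact ⟨h i j, h i j⟩
  exact ((StarSubalgebra.mem_centralizer_iff ℂ).mp (hle ha) x rfl).1

theorem IsMagicIsometry.commute_sq_entry {C : Type u} [CStarAlgebra C]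
    {P : Matrix (Fin 2) (Fin 4) C} (hP : IsMagicIsometry P) {j k : Fin 4} (hjk : j ≠ k)
    (i : Fin 2) (l : Fin 4) : Commute ((colSum P j + colSum P k - 1) ^ 2) (P i l) := by
  by_cases hl : l = j
  · exact hl ▸ hP.commute_sq hjk i
  by_cases hl' : l = k
  · rw [add_comm]
    exact hl' ▸ hP.commute_sq hjk.symm i
  -- An entry outside columns `j` and `k` is handled by the complementary pair, which has the same
  -- square.
  obtain ⟨m, hm⟩ : ∃ m : Fin 4, [j, k, l, m].Nodup := by
    revert j k l; decide
  rw [← hP.sq_eq_sq_of_nodup hm]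
  exact hP.commute_sq (by rintro rfl; simp at hm) i

theorem mainTheorem5 {A : Type u} [CStarAlgebra A] (P : Matrix (Fin 2) (Fin 4) A)
    (hP : IsMagicIsometry P) : CanBeFilledUp (by norm_num : 2 ≤ 4) P := by
  obtain ⟨B, hB, U, f, hU, hf, hfU⟩ := hP.entryMatrix.exists_filling_of_central
    fun j k hjk a => Subtype.ext (commute_of_commute_entries (hP.isSelfAdjoint_sq j k)
      (hP.commute_sq_entry hjk) a.2)
  exact ⟨B, hB, U, hU, f, hf, hfU⟩
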